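/- **Setting.** Let $G=(V,E)$ be a finite directed graph (parallel edges allowed) with distinct vertices $s,t$, edge costs $c:E\to\mathbb R_{>0}$, edge delays $d:E\to\mathbb R_{>0}$, bounds $C,D>0$ and $k\in\mathbb N$. The $k$ disjoint bi-constraint path problem ($k$BCP) asks for $k$ edge-disjoint $st$-paths of total cost at most $C$ and total delay at most $D$; assume that such paths exist. **Algorithm.** Let $0<\beta\le 1$ and let $\epsilon\ge 0$ be a parameter. 0. Compute $k$ edge-disjoint $st$-paths $P_1,\dots,P_k$ that minimize the total of $b(e)=\frac{c(e)}{C}+\frac{d(e)}{D}$. 1. If $\sum_i d(P_i)\le(1+\beta)D$, return $P_1,\dots,P_k$. 2. Otherwise let $\overline G$ be $G$ with all edges of $P_1,\dots,P_k$ reversed, their delays negated and their costs replaced by $\epsilon$. 3. Choose a (simple, directed) cycle $O$ in $\overline G$ for which $d(O)/c(O)$ is minimum among all cycles with $d(O)<0$ whose non-reversed edges have total cost at most $C$ (a cycle with $c(O)=0$ and $d(O)<0$ has ratio $-\infty$). 4. Replace $P_1,\dots,P_k$ by $k$ edge-disjoint $st$-paths composed of exactly the edges of $P_1,\dots,P_k$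 and $O$, except that an edge and its reversal cancel each other. Go to step 1. **Theorem.** The algorithm is a bifactor $\left(1+\beta,\ \max\{2,\,1+\ln\frac1\beta\}\right)$-approximation for $k$BCP: there is $\epsilon_0>0$, depending only on the instance, such that for all $0\le\epsilon<\epsilon_0$ and all $0<\beta\le1$, whatever choices are made in steps 0, 3 and 4, the algorithm never gets stuck, terminates after finitely many steps, and returns $k$ edge-disjoint $st$-paths of total delay at most $(1+\beta)D$ and total cost at most $\max\{2,\,1+\ln\frac1\beta\}\cdot C$. If all costs, all delays, $C$ and $D$ are integers, the same holds for every $0<\epsilon<\frac{1}{mnD}$, where $m=|E|$ and $n=|V|$. -/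

import Mathlib

/-! Directed multigraphs are given by two maps `src tgt : E → V` on a type `E` of edges. -/

/-- `l` is the list of edges of a directed walk from `u` to `v`. -/
def IsWalk {V E : Type*} (src tgt : E → V) : V → List E → V → Prop
  | u, [], v => u = v
  | u, e :: l, v => src e = u ∧ IsWalk src tgt (tgt e) l v

/-- `l` is the list of edges of a directed simple path from `u` to `v`. -/
def IsPath {V E : Type*} (src tgt : E → V) (u v : V) (l : List E) : Prop :=
  IsWalk src tgt u l v ∧ (u :: l.map tgt).Nodup

/-- `l` is the list of edges of a directed simple cycle. -/
def IsCycle {V E : Type*} (src tgt : E → V) (l : List E) : Prop :=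
  l ≠ [] ∧ (∃ u, IsWalk src tgt u l u) ∧ (l.map tgt).Nodup

/-- An instance of the `k` disjoint bi-constraint path problem on vertices `V` and edges `E`. -/
structure KBCP (V E : Type*) where
  /-- tail of an edge -/
  src : E → V
  /-- head of an edge -/
  tgt : E → V
  /-- source terminal -/
  s : V
  /-- target terminal -/
  t : V
  s_ne_t : s ≠ t
  /-- number of paths asked for -/
  k : ℕ
  /-- edge cost -/
  cost : E → ℝ
  /-- edge delay -/
  delay : E → ℝ
  cost_pos : ∀ e, 0 < cost e
  delay_pos : ∀ e, 0 < delay e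
  /-- cost bound -/
  C : ℝ
  /-- delay bound -/
  D : ℝ
  C_pos : 0 < C
  D_pos : 0 < D

/-- Configurations of the algorithm. A family `P : Fin k → List E` is a list of `k` paths. -/
inductive Config (E : Type*) (k : ℕ)
  /-- nothing has been computed -/
  | start : Config E k
  /-- the current paths, about to be tested against the delay bound -/
  | paths (P : Fin k → List E) : Config E k
  /-- the current paths and the cycle chosen to improve them -/
  | cycle (P : Fin k → List E) (O : List E) : Config E k
  /-- the algorithm has terminated and returned these paths -/
  | returned (P : Fin k → List E) : Config E k

namespace KBCP

variable {V E : Type*}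

/-- `P` consists of `k` pairwise edge-disjoint `st`-paths. -/
def IsDisjointPaths (I : KBCP V E) (P : Fin I.k → List E) : Prop :=
  (∀ i, IsPath I.src I.tgt I.s I.t (P i)) ∧ Pairwise fun i j => (P i).Disjoint (P j)

/-- The sum of the weights `w` over the edges of the paths `P`. -/
def pathSum (I : KBCP V E) (w : E → ℝ) (P : Fin I.k → List E) : ℝ :=
  ∑ i, ((P i).map w).sum

/-- There are `k` disjoint `st`-paths that obey both bounds. -/
def Feasible (I : KBCP V E) : Prop :=
  ∃ P, I.IsDisjointPaths P ∧ I.pathSum I.cost P ≤ I.C ∧ I.pathSum I.delay P ≤ I.D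

/-- All costs, all delays and both bounds are integers. -/
def Integral (I : KBCP V E) : Prop :=
  (∀ e, ∃ z : ℤ, I.cost e = z) ∧ (∀ e, ∃ z : ℤ, I.delay e = z) ∧
    (∃ z : ℤ, I.C = z) ∧ ∃ z : ℤ, I.D = z

/-- The mixed cost `b(e) = c(e)/C + d(e)/D`. -/
noncomputable def mixed (I : KBCP V E) (e : E) : ℝ :=
  I.cost e / I.C + I.delay e / I.D

/-- The outcome of the basic algorithm: `k` disjoint `st`-paths of minimum total mixed cost. -/
def IsBasicOutput (I : KBCP V E) (P : Fin I.k → List E) : Prop :=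
  I.IsDisjointPaths P ∧
    ∀ Q, I.IsDisjointPaths Q → I.pathSum I.mixed P ≤ I.pathSum I.mixed Q

variable [DecidableEq E]

/-- The set of the edges of the paths `P`. -/
def edges (I : KBCP V E) (P : Fin I.k → List E) : Finset E :=
  Finset.univ.biUnion fun i => (P i).toFinset

/-! The residual graph of a set `F` of edges has the same edges as the graph, but those in `F`
are reversed, their delay is negated, and their cost is replaced by a constant `ε`. -/

/-- tail of an edge in the residual graph -/
def resSrc (I : KBCP V E) (F : Finset E) (e : E) : V := if e ∈ F then I.tgt e else I.src e

/-- head of an edge in the residual graph -/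
def resTgt (I : KBCP V E) (F : Finset E) (e : E) : V := if e ∈ F then I.src e else I.tgt e

/-- cost of the cycle `O` in the residual graph, a reversed edge having cost `ε` -/
def resCost (I : KBCP V E) (ε : ℝ) (F : Finset E) (O : List E) : ℝ :=
  (O.map fun e => if e ∈ F then ε else I.cost e).sum

/-- delay of the cycle `O` in the residual graph -/
def resDelay (I : KBCP V E) (F : Finset E) (O : List E) : ℝ :=
  (O.map fun e => if e ∈ F then -I.delay e else I.delay e).sum

/-- `O` is a cycle of the residual graph with negative delay whose edges of the original graph
cost at most `C` in total (reversed edges do not count towards the bound). -/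
def IsAdmissibleCycle (I : KBCP V E) (F : Finset E) (O : List E) : Prop :=
  IsCycle (I.resSrc F) (I.resTgt F) O ∧ I.resCost 0 F O ≤ I.C ∧ I.resDelay F O < 0

/-- `O` is an admissible cycle for which the ratio of delay to cost is minimum. The ratios
`d(O)/c(O) ≤ d(O')/c(O')` are compared after multiplication with the costs, so that a cycle of
cost `0`, which can only occur for `ε = 0`, has ratio `-∞`. -/
def IsBestCycle (I : KBCP V E) (ε : ℝ) (F : Finset E) (O : List E) : Prop :=
  I.IsAdmissibleCycle F O ∧ ∀ O', I.IsAdmissibleCycle F O' →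
    I.resDelay F O * I.resCost ε F O' ≤ I.resDelay F O' * I.resCost ε F O

/-- The transitions of the cycle cancellation algorithm with parameters `β` and `ε`. -/
inductive Step (I : KBCP V E) (β ε : ℝ) : Config E I.k → Config E I.k → Prop
  /-- start from an outcome of the basic algorithm -/
  | basic (P : Fin I.k → List E) (h : I.IsBasicOutput P) : Step I β ε .start (.paths P)
  /-- return as soon as the delay is at most `(1 + β) D` -/
  | halt (P : Fin I.k → List E) (h : I.pathSum I.delay P ≤ (1 + β) * I.D) :
      Step I β ε (.paths P) (.returned P)
  /-- otherwise choose an admissible cycle of minimum ratio in the residual graph -/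
  | choose (P : Fin I.k → List E) (O : List E) (h : (1 + β) * I.D < I.pathSum I.delay P)
      (hO : I.IsBestCycle ε (I.edges P) O) : Step I β ε (.paths P) (.cycle P O)
  /-- replace the paths by `k` disjoint paths composed of their edges and those of the cycle,
  an edge of the paths and its reversal in the cycle cancelling each other -/
  | cancel (P Q : Fin I.k → List E) (O : List E) (hQ : I.IsDisjointPaths Q)
      (h : I.edges Q = symmDiff (I.edges P) O.toFinset) : Step I β ε (.cycle P O) (.paths Q)

end KBCP

/-- A (nondeterministic) algorithm, given by its transitions `step`, computes on the instance `I`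
`k` disjoint `st`-paths of total delay at most `a * D` and total cost at most `b * C`: it has no
infinite run, and every run that cannot be continued has returned such paths. -/
def IsBifactorApproxOn {V E : Type*} (I : KBCP V E)
    (step : Config E I.k → Config E I.k → Prop) (a b : ℝ) : Prop :=
  (¬ ∃ r : ℕ → Config E I.k, r 0 = .start ∧ ∀ n, step (r n) (r (n + 1))) ∧
    ∀ x, Relation.ReflTransGen step .start x → (∀ y, ¬ step x y) →
      ∃ P, x = .returned P ∧ I.IsDisjointPaths P ∧
        I.pathSum I.delay P ≤ a * I.D ∧ I.pathSum I.cost P ≤ b * I.C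

section DirectedMultigraph

variable {V E : Type*} {src tgt : E → V}

open Classical in
/-- The contribution of the edge `e` to the net outflow at the vertex `v`. -/
noncomputable def netOut (src tgt : E → V) (v : V) (e : E) : ℤ :=
  (if src e = v then 1 else 0) - (if tgt e = v then 1 else 0)

/-- Every vertex has as many outgoing as incoming edges in `X`. -/
def IsBalanced (src tgt : E → V) (X : Finset E) : Prop :=
  ∀ v, ∑ e ∈ X, netOut src tgt v e = 0

open Classical in
/-- `X` is a flow of value `k` from `s` to `t`. -/
def IsFlow (src tgt : E → V) (s t : V) (k : ℕ) (X : Finset E) : Prop :=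
  ∀ v, ∑ e ∈ X, netOut src tgt v e = k * ((if s = v then 1 else 0) - (if t = v then 1 else 0))

/-- No directed cycle has all of its edges in `X`. -/
def IsAcyclicSet (src tgt : E → V) (X : Finset E) : Prop :=
  ∀ l, IsCycle src tgt l → ¬ ∀ e ∈ l, e ∈ X

theorem IsAcyclicSet.mono {X Y : Finset E} (h : IsAcyclicSet src tgt Y) (hXY : X ⊆ Y) :
    IsAcyclicSet src tgt X :=
  fun l hl hX => h l hl fun e he => hXY (hX e he)

theorem IsWalk.append {u v w : V} {l l' : List E} (h : IsWalk src tgt u l v)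
    (h' : IsWalk src tgt v l' w) : IsWalk src tgt u (l ++ l') w := by
  induction l generalizing u with
  | nil => obtain rfl : u = v := h; exact h'
  | cons e l ih => exact ⟨h.1, ih h.2⟩

open Classical in
theorem IsWalk.sum_netOut {u v : V} {l : List E} (h : IsWalk src tgt u l v) (x : V) :
    (l.map (netOut src tgt x)).sum = (if u = x then 1 else 0) - (if v = x then 1 else 0) := by
  induction l generalizing u with
  | nil => obtain rfl : u = v := h; simp
  | cons e l ih =>
    obtain ⟨rfl, h⟩ := h
    rw [List.map_cons, List.sum_cons, ih h, netOut]
    ring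

theorem IsWalk.exists_suffix {u v w : V} {l : List E} (h : IsWalk src tgt u l v)
    (hl : (u :: l.map tgt).Nodup) (hw : w ∈ u :: l.map tgt) :
    ∃ l', l' <:+ l ∧ IsWalk src tgt w l' v ∧ (w :: l'.map tgt).Nodup := by
  induction l generalizing u with
  | nil =>
    obtain rfl : w = u := by simpa using hw
    exact ⟨[], List.suffix_rfl, h, hl⟩
  | cons e l ih =>
    rcases List.mem_cons.1 hw with rfl | hw
    · exact ⟨e :: l, List.suffix_rfl, h, hl⟩
    · obtain ⟨l', h₁, h₂⟩ := ih h.2 (List.nodup_cons.1 hl).2 hw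
      exact ⟨l', h₁.trans (List.suffix_cons e l), h₂⟩

theorem IsPath.nodup {u v : V} {l : List E} (h : IsPath src tgt u v l) : l.Nodup :=
  List.Nodup.of_map tgt (List.nodup_cons.1 h.2).2

theorem IsCycle.nodup {l : List E} (h : IsCycle src tgt l) : l.Nodup :=
  List.Nodup.of_map tgt h.2.2

theorem IsCycle.isBalanced [DecidableEq E] {l : List E} (h : IsCycle src tgt l) :
    IsBalanced src tgt l.toFinset := by
  intro v
  obtain ⟨u, hu⟩ := h.2.1
  rw [List.sum_toFinset _ h.nodup, hu.sum_netOut, sub_self]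

theorem IsPath.isFlow_one [DecidableEq E] {s t : V} {l : List E} (h : IsPath src tgt s t l) :
    IsFlow src tgt s t 1 l.toFinset := by
  classical
  intro v
  rw [List.sum_toFinset _ h.nodup, h.1.sum_netOut]
  simp

/-- In an acyclic set of edges every vertex has a simple path to a sink. -/
theorem IsAcyclicSet.exists_path_to_sink [Fintype V] {X : Finset E}
    (hX : IsAcyclicSet src tgt X) (u : V) :
    ∃ l v, IsPath src tgt u v l ∧ (∀ e ∈ l, e ∈ X) ∧ ∀ e ∈ X, src e ≠ v := by
  by_contra! H
  have key : ∀ n : ℕ, ∃ l v, IsPath src tgt u v l ∧ (∀ e ∈ l, e ∈ X) ∧ l.length = n := by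
    intro n
    induction n with
    | zero => exact ⟨[], u, ⟨rfl, by simp⟩, by simp, rfl⟩
    | succ n ih =>
      obtain ⟨l, v, hl, hlX, rfl⟩ := ih
      obtain ⟨e, he, hev⟩ := H l v hl hlX
      by_cases hmem : tgt e ∈ u :: l.map tgt
      · obtain ⟨l', hs, hw, hn⟩ := hl.1.exists_suffix hl.2 hmem
        refine absurd ?_ (hX (l' ++ [e]) ⟨by simp, ⟨tgt e, hw.append ⟨hev, rfl⟩⟩, ?_⟩)
        · intro f hf
          rcases List.mem_append.1 hf with hf | hf
          · exact hlX f (hs.subset hf)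
          · rwa [List.mem_singleton.1 hf]
        · rw [List.map_append, List.map_singleton]
          exact (List.perm_append_singleton _ _).nodup_iff.2 hn
      · refine ⟨l ++ [e], tgt e, ⟨hl.1.append ⟨hev, rfl⟩, ?_⟩, ?_, by simp⟩
        · rw [List.map_append, List.map_singleton, ← List.cons_append]
          exact (List.perm_append_singleton _ _).nodup_iff.2 (List.nodup_cons.2 ⟨hmem, hl.2⟩)
        · intro f hf
          rcases List.mem_append.1 hf with hf | hf
          · exact hlX f hf
          · rwa [List.mem_singleton.1 hf]
  obtain ⟨l, v, hl, -, hn⟩ := key (Fintype.card V)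
  have := hl.2.length_le_card
  simp at this
  omega

theorem sum_netOut_nonpos_of_sink {X : Finset E} {v : V} (hv : ∀ e ∈ X, src e ≠ v) :
    ∑ e ∈ X, netOut src tgt v e ≤ 0 := by
  refine Finset.sum_nonpos fun e he => ?_
  rw [netOut, if_neg (hv e he)]
  split_ifs <;> simp

theorem sum_netOut_neg_of_sink {X : Finset E} {u v : V} {l : List E}
    (hl : IsWalk src tgt u l v) (huv : u ≠ v) (hlX : ∀ e ∈ l, e ∈ X)
    (hv : ∀ e ∈ X, src e ≠ v) : ∑ e ∈ X, netOut src tgt v e < 0 := by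
  have h := hl.sum_netOut v
  rw [if_neg huv, if_pos rfl] at h
  obtain ⟨e, he, hne⟩ : ∃ e ∈ l, netOut src tgt v e ≠ 0 := by
    by_contra! H
    rw [List.sum_eq_zero (by simpa using H)] at h
    omega
  refine Finset.sum_neg' (fun f hf => ?_) ⟨e, hlX e he, lt_of_le_of_ne ?_ hne⟩
  · rw [netOut, if_neg (hv f hf)]
    split_ifs <;> simp
  · rw [netOut, if_neg (hv e (hlX e he))]
    split_ifs <;> simp

theorem IsBalanced.eq_empty_of_acyclic [Fintype V] {X : Finset E} (hb : IsBalanced src tgt X)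
    (hX : IsAcyclicSet src tgt X) : X = ∅ := by
  by_contra hne
  obtain ⟨e, he⟩ := Finset.nonempty_iff_ne_empty.2 hne
  obtain ⟨l, v, hl, hlX, hv⟩ := hX.exists_path_to_sink (src e)
  exact (sum_netOut_neg_of_sink hl.1 (hv e he) hlX hv).ne (hb v)

theorem IsBalanced.exists_cycle [Fintype V] {X : Finset E} (hb : IsBalanced src tgt X)
    (hX : X.Nonempty) : ∃ l, IsCycle src tgt l ∧ ∀ e ∈ l, e ∈ X := by
  by_contra! H
  refine hX.ne_empty (hb.eq_empty_of_acyclic fun l hl hlX => ?_)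
  obtain ⟨e, he, h⟩ := H l hl
  exact h (hlX e he)

/-- A balanced set of edges is a disjoint union of cycles; hence a weight that is nonnegative on
its cycles is nonnegative on the set. -/
theorem IsBalanced.sum_nonneg [Fintype V] [DecidableEq E] {X : Finset E}
    (hb : IsBalanced src tgt X) (g : E → ℝ)
    (hg : ∀ l, IsCycle src tgt l → (∀ e ∈ l, e ∈ X) → 0 ≤ ∑ e ∈ l.toFinset, g e) :
    0 ≤ ∑ e ∈ X, g e := by
  induction X using Finset.strongInduction with
  | H X ih =>
    rcases X.eq_empty_or_nonempty with rfl | hne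
    · simp
    obtain ⟨l, hl, hlX⟩ := hb.exists_cycle hne
    have hsub : l.toFinset ⊆ X := fun e he => hlX e (List.mem_toFinset.1 he)
    rw [← Finset.sum_sdiff hsub]
    refine add_nonneg (ih _ ?_ ?_ ?_) (hg l hl hlX)
    · exact Finset.sdiff_ssubset hsub (List.toFinset_nonempty_iff l |>.2 hl.1)
    · intro v
      have := hb v
      rwa [← Finset.sum_sdiff hsub, hl.isBalanced v, add_zero] at this
    · exact fun l' hl' h => hg l' hl' fun e he => (Finset.mem_sdiff.1 (h e he)).1

/-- An acyclic flow of value `k` is composed of `k` disjoint simple paths. -/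
theorem IsFlow.exists_paths [Fintype V] [DecidableEq E] {s t : V} (hst : s ≠ t) {k : ℕ}
    {X : Finset E} (hf : IsFlow src tgt s t k X) (hX : IsAcyclicSet src tgt X) :
    ∃ P : Fin k → List E, (∀ i, IsPath src tgt s t (P i)) ∧
      (Pairwise fun i j => (P i).Disjoint (P j)) ∧
      (Finset.univ.biUnion fun i => (P i).toFinset) = X := by
  classical
  induction k generalizing X with
  | zero =>
    have : X = ∅ := IsBalanced.eq_empty_of_acyclic (fun v => by simpa using hf v) hX
    exact ⟨fun _ => [], fun i => i.elim0, fun i => i.elim0, by simp [this]⟩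
  | succ k ih =>
    obtain ⟨l, v, hl, hlX, hv⟩ := hX.exists_path_to_sink s
    obtain rfl : v = t := by
      by_contra hvt
      have h0 := hf v
      by_cases hsv : s = v
      · subst hsv
        have := sum_netOut_nonpos_of_sink (tgt := tgt) hv
        rw [if_pos rfl, if_neg (Ne.symm hvt)] at h0
        push_cast at h0
        omega
      · have := sum_netOut_neg_of_sink hl.1 hsv hlX hv
        rw [if_neg hsv, if_neg (Ne.symm hvt)] at h0
        simp at h0
        omega
    have hsub : l.toFinset ⊆ X := fun e he => hlX e (List.mem_toFinset.1 he)
    obtain ⟨P, hP, hd, hu⟩ := ih (X := X \ l.toFinset) (fun x => by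
      have h1 := hf x
      rw [← Finset.sum_sdiff hsub, hl.isFlow_one x] at h1
      push_cast at h1 ⊢
      linarith) (hX.mono Finset.sdiff_subset)
    have hPl : ∀ i, ∀ e ∈ P i, e ∉ l := by
      intro i e he hel
      have : e ∈ X \ l.toFinset := by
        rw [← hu]; exact Finset.mem_biUnion.2 ⟨i, Finset.mem_univ _, List.mem_toFinset.2 he⟩
      exact (Finset.mem_sdiff.1 this).2 (List.mem_toFinset.2 hel)
    refine ⟨Fin.cons l P, ?_, ?_, ?_⟩
    · intro i
      cases i using Fin.cases with
      | zero => simpa using hl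
      | succ i => simpa using hP i
    · intro i j hij
      cases i using Fin.cases with
      | zero =>
        cases j using Fin.cases with
        | zero => exact absurd rfl hij
        | succ j => exact fun e he he' => hPl j e he' he
      | succ i =>
        cases j using Fin.cases with
        | zero => exact fun e he he' => hPl i e he he'
        | succ j => simpa using hd fun h => hij (by rw [h])
    · ext e
      have := congrArg (e ∈ ·) hu
      simp only [Finset.mem_biUnion, Finset.mem_univ, true_and, List.mem_toFinset,
        Finset.mem_sdiff, eq_iff_iff] at this
      simp only [Finset.mem_biUnion, Finset.mem_univ, true_and, List.mem_toFinset,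
        Fin.exists_fin_succ, Fin.cons_zero, Fin.cons_succ, this]
      by_cases hel : e ∈ l
      · simp [hel, hlX e hel]
      · simp [hel]

/-- Every flow contains an acyclic flow of the same value. -/
theorem IsFlow.exists_acyclic_subset [DecidableEq E] {s t : V} {k : ℕ}
    {X : Finset E} (hf : IsFlow src tgt s t k X) :
    ∃ Y ⊆ X, IsFlow src tgt s t k Y ∧ IsAcyclicSet src tgt Y := by
  induction X using Finset.strongInduction with
  | H X ih =>
    by_cases hX : IsAcyclicSet src tgt X
    · exact ⟨X, subset_rfl, hf, hX⟩
    unfold IsAcyclicSet at hX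
    push Not at hX
    obtain ⟨l, hl, hlX⟩ := hX
    have hsub : l.toFinset ⊆ X := fun e he => hlX e (List.mem_toFinset.1 he)
    obtain ⟨Y, hY, h⟩ := ih (X \ l.toFinset)
      (Finset.sdiff_ssubset hsub (List.toFinset_nonempty_iff l |>.2 hl.1)) (fun v => by
        have := hf v
        rwa [← Finset.sum_sdiff hsub, hl.isBalanced v, add_zero] at this)
    exact ⟨Y, hY.trans Finset.sdiff_subset, h⟩

end DirectedMultigraph

namespace KBCP

variable {V E : Type*}

theorem card_mul_le [Fintype E] {ε : ℝ} (hε : 0 ≤ ε) (X : Finset E) :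
    (X.card : ℝ) * ε ≤ Fintype.card E * ε :=
  mul_le_mul_of_nonneg_right (by exact_mod_cast X.card_le_univ) hε

section Residual

variable [DecidableEq E] (I : KBCP V E)

/-- cost of a single edge of the residual graph -/
def arcCost (ε : ℝ) (F : Finset E) (e : E) : ℝ := if e ∈ F then ε else I.cost e

/-- delay of a single edge of the residual graph -/
def arcDelay (F : Finset E) (e : E) : ℝ := if e ∈ F then -I.delay e else I.delay e

variable {I} {ε : ℝ} {F X : Finset E} {O : List E}

theorem sum_residual {R : Type*} [AddCommGroup R] (F X : Finset E) (a : E → R) :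
    ∑ e ∈ X, (if e ∈ F then -a e else a e) = ∑ e ∈ symmDiff F X, a e - ∑ e ∈ F, a e := by
  have h₁ : ∑ e ∈ symmDiff F X, a e = ∑ e ∈ F \ X, a e + ∑ e ∈ X \ F, a e := by
    rw [symmDiff_def, Finset.sup_eq_union, Finset.sum_union]
    exact disjoint_sdiff_sdiff
  have h₂ := Finset.sum_inter_add_sum_sdiff F X a
  have h₃ := Finset.sum_inter_add_sum_sdiff X F fun e => if e ∈ F then -a e else a e
  have h₄ : ∑ e ∈ X ∩ F, (if e ∈ F then -a e else a e) = - ∑ e ∈ F ∩ X, a e := by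
    rw [Finset.inter_comm, ← Finset.sum_neg_distrib]
    exact Finset.sum_congr rfl fun e he => if_pos (Finset.mem_inter.1 he).1
  have h₅ : ∑ e ∈ X \ F, (if e ∈ F then -a e else a e) = ∑ e ∈ X \ F, a e :=
    Finset.sum_congr rfl fun e he => if_neg (Finset.mem_sdiff.1 he).2
  rw [← h₃, h₄, h₅, h₁, ← h₂]
  abel

theorem sum_netOut_residual (F X : Finset E) (v : V) :
    ∑ e ∈ X, netOut (I.resSrc F) (I.resTgt F) v e =
      ∑ e ∈ symmDiff F X, netOut I.src I.tgt v e - ∑ e ∈ F, netOut I.src I.tgt v e := by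
  rw [← sum_residual]
  refine Finset.sum_congr rfl fun e _ => ?_
  by_cases he : e ∈ F
  · rw [if_pos he, netOut, netOut, resSrc, resTgt, if_pos he, if_pos he, neg_sub]
  · rw [if_neg he, netOut, netOut, resSrc, resTgt, if_neg he, if_neg he]

theorem sum_arcDelay (F X : Finset E) : ∑ e ∈ X, I.arcDelay F e =
    ∑ e ∈ symmDiff F X, I.delay e - ∑ e ∈ F, I.delay e :=
  sum_residual F X I.delay

theorem resCost_eq_sum {src tgt : E → V} (hO : IsCycle src tgt O) :
    I.resCost ε F O = ∑ e ∈ O.toFinset, I.arcCost ε F e :=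
  (List.sum_toFinset _ hO.nodup).symm

theorem resDelay_eq_sum {src tgt : E → V} (hO : IsCycle src tgt O) :
    I.resDelay F O = ∑ e ∈ O.toFinset, I.arcDelay F e :=
  (List.sum_toFinset _ hO.nodup).symm

theorem arcCost_nonneg (hε : 0 ≤ ε) (e : E) : 0 ≤ I.arcCost ε F e := by
  unfold arcCost
  split_ifs
  exacts [hε, (I.cost_pos e).le]

theorem sum_arcCost_nonneg (hε : 0 ≤ ε) : 0 ≤ ∑ e ∈ X, I.arcCost ε F e :=
  Finset.sum_nonneg fun e _ => arcCost_nonneg hε e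

theorem sum_arcCost_mono (hε : 0 ≤ ε) {Y : Finset E} (h : X ⊆ Y) :
    ∑ e ∈ X, I.arcCost ε F e ≤ ∑ e ∈ Y, I.arcCost ε F e :=
  Finset.sum_le_sum_of_subset_of_nonneg h fun e _ _ => arcCost_nonneg hε e

theorem sum_arcCost (F X : Finset E) : ∑ e ∈ X, I.arcCost ε F e =
    ∑ e ∈ X \ F, I.cost e + (X ∩ F).card * ε := by
  rw [← Finset.sum_inter_add_sum_sdiff X F, add_comm]
  congr 1
  · exact Finset.sum_congr rfl fun e he => if_neg (Finset.mem_sdiff.1 he).2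
  · rw [← nsmul_eq_mul, ← Finset.sum_const]
    exact Finset.sum_congr rfl fun e he => if_pos (Finset.mem_inter.1 he).2

/-- The ratio of a best cycle is at most that of any balanced set of edges of the residual graph
whose unreversed edges cost at most `C`. -/
theorem IsBestCycle.ratio_le [Fintype V] (hO : I.IsBestCycle ε F O) (hε : 0 ≤ ε)
    (hX : IsBalanced (I.resSrc F) (I.resTgt F) X) (hXC : ∑ e ∈ X, I.arcCost 0 F e ≤ I.C) :
    I.resDelay F O * ∑ e ∈ X, I.arcCost ε F e ≤
      (∑ e ∈ X, I.arcDelay F e) * I.resCost ε F O := by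
  have hc : 0 ≤ I.resCost ε F O := by
    rw [resCost_eq_sum hO.1.1]
    exact sum_arcCost_nonneg hε
  have hsum : ∀ Y : Finset E,
      ∑ e ∈ Y, (I.arcDelay F e * I.resCost ε F O - I.resDelay F O * I.arcCost ε F e) =
        (∑ e ∈ Y, I.arcDelay F e) * I.resCost ε F O -
          I.resDelay F O * ∑ e ∈ Y, I.arcCost ε F e := fun Y => by
    rw [Finset.sum_sub_distrib, Finset.sum_mul, Finset.mul_sum]
  rw [← sub_nonneg, ← hsum]
  refine hX.sum_nonneg _ fun l hl hlX => ?_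
  rw [hsum, sub_nonneg]
  have hsub : l.toFinset ⊆ X := fun e he => hlX e (List.mem_toFinset.1 he)
  rcases lt_or_ge (∑ e ∈ l.toFinset, I.arcDelay F e) 0 with hd | hd
  · rw [← resDelay_eq_sum hl, ← resCost_eq_sum hl]
    refine hO.2 l ⟨hl, ?_, by rwa [resDelay_eq_sum hl]⟩
    rw [resCost_eq_sum hl]
    exact (sum_arcCost_mono le_rfl hsub).trans hXC
  · exact (mul_nonpos_of_nonpos_of_nonneg hO.1.2.2.le (sum_arcCost_nonneg hε)).trans
      (mul_nonneg hd hc)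

theorem isBalanced_symmDiff {F Y : Finset E}
    (h : ∀ v, ∑ e ∈ Y, netOut I.src I.tgt v e = ∑ e ∈ F, netOut I.src I.tgt v e) :
    IsBalanced (I.resSrc F) (I.resTgt F) (symmDiff F Y) := by
  intro v
  rw [sum_netOut_residual, symmDiff_symmDiff_cancel_left, h, sub_self]

theorem sum_netOut_symmDiff (hO : IsCycle (I.resSrc F) (I.resTgt F) O) (v : V) :
    ∑ e ∈ symmDiff F O.toFinset, netOut I.src I.tgt v e = ∑ e ∈ F, netOut I.src I.tgt v e := by
  rw [← sub_eq_zero, ← sum_netOut_residual]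
  exact hO.isBalanced v

theorem exists_mem_inter_of_delay_neg (hO : IsCycle (I.resSrc F) (I.resTgt F) O)
    (hd : I.resDelay F O < 0) : ∃ e ∈ O.toFinset, e ∈ F := by
  by_contra! H
  rw [resDelay_eq_sum hO] at hd
  refine hd.not_ge (Finset.sum_nonneg fun e he => ?_)
  rw [arcDelay, if_neg (H e he)]
  exact (I.delay_pos e).le

theorem exists_notMem_of_acyclic [Fintype V] (hF : IsAcyclicSet I.src I.tgt F)
    (hO : IsCycle (I.resSrc F) (I.resTgt F) O) : ∃ e ∈ O.toFinset, e ∉ F := by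
  by_contra! H
  refine (List.toFinset_nonempty_iff O |>.2 hO.1).ne_empty
    (IsBalanced.eq_empty_of_acyclic (src := I.src) (tgt := I.tgt) (fun v => ?_) (hF.mono H))
  have h := sum_netOut_symmDiff hO v
  rw [symmDiff_of_ge H, ← Finset.sum_sdiff H] at h
  simpa using h

theorem resCost_pos_of_acyclic [Fintype V] (hF : IsAcyclicSet I.src I.tgt F) (hε : 0 ≤ ε)
    (hO : IsCycle (I.resSrc F) (I.resTgt F) O) : 0 < I.resCost ε F O := by
  obtain ⟨e, he, heF⟩ := exists_notMem_of_acyclic hF hO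
  rw [resCost_eq_sum hO]
  refine Finset.sum_pos' (fun e _ => arcCost_nonneg hε e) ⟨e, he, ?_⟩
  rw [arcCost, if_neg heF]
  exact I.cost_pos e

/-- If reversed edges are cheap enough, cancelling a best cycle creates no cycles. -/
theorem IsBestCycle.isAcyclicSet_symmDiff [Fintype V] [Fintype E]
    (hO : I.IsBestCycle ε F O) (hF : IsAcyclicSet I.src I.tgt F) (hε : 0 ≤ ε)
    (hsmall : ∀ e, Fintype.card E * ε < I.cost e) :
    IsAcyclicSet I.src I.tgt (symmDiff F O.toFinset) := by
  intro l hl hlX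
  set A := O.toFinset with hA
  set Z := l.toFinset with hZ
  have hZX : Z ⊆ symmDiff F A := fun e he => hlX e (List.mem_toFinset.1 he)
  have hZ' : symmDiff (symmDiff F A) Z = symmDiff F A \ Z :=
    symmDiff_of_ge hZX
  have hbal : IsBalanced (I.resSrc F) (I.resTgt F) (symmDiff A Z) := by
    intro v
    have h := Finset.sum_sdiff (f := netOut I.src I.tgt v) hZX
    rw [sum_netOut_residual, ← symmDiff_assoc, hZ']
    rw [hl.isBalanced v, sum_netOut_symmDiff hO.1.1] at h
    omega
  have hdel : ∑ e ∈ symmDiff A Z, I.arcDelay F e < I.resDelay F O := by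
    have h := Finset.sum_sdiff (f := I.delay) hZX
    have hpos : 0 < ∑ e ∈ Z, I.delay e :=
      Finset.sum_pos (fun e _ => I.delay_pos e) (List.toFinset_nonempty_iff l |>.2 hl.1)
    rw [resDelay_eq_sum hO.1.1, sum_arcDelay, sum_arcDelay, ← symmDiff_assoc, hZ']
    linarith
  obtain ⟨e₀, he₀, he₀F⟩ : ∃ e ∈ Z, e ∉ F := by
    by_contra! H
    exact hF l hl fun e he => H e (List.mem_toFinset.2 he)
  have hout : symmDiff A Z \ F ⊆ (A \ F).erase e₀ := by
    intro e he
    have h₁ : e ∈ Z → e ∈ symmDiff F A := @hZX e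
    have h₂ := hZX he₀
    simp only [Finset.mem_sdiff, Finset.mem_symmDiff, Finset.mem_erase] at he h₁ h₂ ⊢
    refine ⟨?_, ?_⟩
    · rintro rfl
      tauto
    · tauto
  have he₀A : e₀ ∈ A \ F := by
    have h₂ := hZX he₀
    simp only [Finset.mem_sdiff, Finset.mem_symmDiff] at h₂ ⊢
    tauto
  have hcost : ∑ e ∈ symmDiff A Z \ F, I.cost e + I.cost e₀ ≤ ∑ e ∈ A \ F, I.cost e := by
    rw [← Finset.sum_erase_add _ _ he₀A]
    gcongr
    exact fun e _ _ => (I.cost_pos e).le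
  have hc₀ : ∑ e ∈ symmDiff A Z, I.arcCost 0 F e ≤ I.C := by
    have h := hO.1.2.1
    rw [resCost_eq_sum hO.1.1, sum_arcCost, mul_zero] at h
    rw [sum_arcCost, mul_zero]
    linarith [I.cost_pos e₀]
  have hcε : ∑ e ∈ symmDiff A Z, I.arcCost ε F e ≤ I.resCost ε F O := by
    rw [resCost_eq_sum hO.1.1, sum_arcCost, sum_arcCost]
    have h₁ := card_mul_le hε (symmDiff A Z ∩ F)
    have h₂ : 0 ≤ ((A ∩ F).card : ℝ) * ε := by positivity
    linarith [hsmall e₀]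
  have hr := hO.ratio_le hε hbal hc₀
  have hpos := resCost_pos_of_acyclic hF hε hO.1.1
  have h₁ := mul_lt_mul_of_pos_right hdel hpos
  have h₂ := mul_le_mul_of_nonpos_left hcε hO.1.2.2.le
  linarith

variable (ε) in
/-- An acyclic set of edges that can be rerouted to one of smaller delay and of cost at most `C`
has a best cycle in its residual graph. -/
theorem exists_isBestCycle [Fintype V] [Fintype E] (hF : IsAcyclicSet I.src I.tgt F)
    (hε : 0 ≤ ε) {Y : Finset E}
    (hY : ∀ v, ∑ e ∈ Y, netOut I.src I.tgt v e = ∑ e ∈ F, netOut I.src I.tgt v e)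
    (hc : ∑ e ∈ Y, I.cost e ≤ I.C) (hd : ∑ e ∈ Y, I.delay e < ∑ e ∈ F, I.delay e) :
    ∃ O, I.IsBestCycle ε F O := by
  obtain ⟨O₀, hO₀⟩ : ∃ O, I.IsAdmissibleCycle F O := by
    by_contra! H
    refine hd.not_ge ?_
    rw [← sub_nonneg]
    conv_rhs => rw [← symmDiff_symmDiff_cancel_left F Y, ← sum_arcDelay]
    refine (isBalanced_symmDiff hY).sum_nonneg _ fun l hl hlX => ?_
    by_contra! hneg
    refine H l ⟨hl, ?_, by rwa [resDelay_eq_sum hl]⟩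
    rw [resCost_eq_sum hl, sum_arcCost, mul_zero, add_zero]
    refine le_trans (Finset.sum_le_sum_of_subset_of_nonneg ?_ fun e _ _ => (I.cost_pos e).le) hc
    intro e he
    have h₁ := hlX e
    simp only [Finset.mem_sdiff, Finset.mem_symmDiff, List.mem_toFinset] at he h₁
    tauto
  obtain ⟨A, ⟨O, hO, rfl⟩, hmin⟩ := Set.exists_min_image
    {A : Finset E | ∃ O, I.IsAdmissibleCycle F O ∧ O.toFinset = A}
    (fun A => (∑ e ∈ A, I.arcDelay F e) / ∑ e ∈ A, I.arcCost ε F e) (Set.toFinite _)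
    ⟨_, O₀, hO₀, rfl⟩
  refine ⟨O, hO, fun O' hO' => ?_⟩
  have h := hmin _ ⟨O', hO', rfl⟩
  simp only [← resDelay_eq_sum hO.1, ← resCost_eq_sum hO.1, ← resDelay_eq_sum hO'.1,
    ← resCost_eq_sum hO'.1] at h
  rwa [div_le_div_iff₀ (resCost_pos_of_acyclic hF hε hO.1)
    (resCost_pos_of_acyclic hF hε hO'.1)] at h

theorem sum_cost_symmDiff_le (hO : IsCycle (I.resSrc F) (I.resTgt F) O) :
    ∑ e ∈ symmDiff F O.toFinset, I.cost e ≤ ∑ e ∈ F, I.cost e + I.resCost 0 F O := by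
  rw [← sub_le_iff_le_add', ← sum_residual, resCost_eq_sum hO]
  refine Finset.sum_le_sum fun e _ => ?_
  unfold arcCost
  split_ifs
  · linarith [I.cost_pos e]
  · exact le_rfl

theorem sum_cost_symmDiff_add_le (hO : IsCycle (I.resSrc F) (I.resTgt F) O) (hε : 0 ≤ ε)
    {e₁ : E} (he₁ : e₁ ∈ O.toFinset) (he₁F : e₁ ∈ F) :
    ∑ e ∈ symmDiff F O.toFinset, I.cost e + I.cost e₁ ≤
      ∑ e ∈ F, I.cost e + I.resCost ε F O := by
  have h : ∑ e ∈ O.toFinset, (if e ∈ F then -I.cost e else I.cost e) + I.cost e₁ ≤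
      ∑ e ∈ O.toFinset, I.arcCost ε F e := by
    rw [← Finset.sum_erase_add _ _ he₁, ← Finset.sum_erase_add _ (I.arcCost ε F) he₁,
      if_pos he₁F, neg_add_cancel_right, arcCost, if_pos he₁F]
    refine le_add_of_le_of_nonneg (Finset.sum_le_sum fun e _ => ?_) hε
    unfold arcCost
    split_ifs
    · linarith [I.cost_pos e]
    · exact le_rfl
  rw [sum_residual, ← resCost_eq_sum hO] at h
  linarith

/-- As long as the delay stays above the delay bound, the increase of the cost is at most `C`
times the relative decrease of the excess delay. -/
theorem IsBestCycle.cost_increase_le [Fintype V] [Fintype E] (hO : I.IsBestCycle ε F O)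
    (hε : 0 ≤ ε) (hsmall : ∀ e, Fintype.card E * ε < I.cost e) {Y : Finset E}
    (hY : ∀ v, ∑ e ∈ Y, netOut I.src I.tgt v e = ∑ e ∈ F, netOut I.src I.tgt v e)
    (hc : ∑ e ∈ Y, I.cost e ≤ I.C) (hd : ∑ e ∈ Y, I.delay e ≤ I.D)
    (hD : I.D ≤ ∑ e ∈ symmDiff F O.toFinset, I.delay e) :
    (∑ e ∈ symmDiff F O.toFinset, I.cost e - ∑ e ∈ F, I.cost e) *
        (∑ e ∈ F, I.delay e - I.D) ≤
      I.C * (∑ e ∈ F, I.delay e - ∑ e ∈ symmDiff F O.toFinset, I.delay e) := by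
  obtain ⟨e₁, he₁, he₁F⟩ := exists_mem_inter_of_delay_neg hO.1.1 hO.1.2.2
  have hinc := sum_cost_symmDiff_add_le hO.1.1 hε he₁ he₁F
  have hdel := sum_arcDelay (I := I) F O.toFinset
  rw [← resDelay_eq_sum hO.1.1] at hdel
  have hneg := hO.1.2.2
  have hsub : ∑ e ∈ symmDiff F Y \ F, I.cost e ≤ I.C := by
    refine le_trans (Finset.sum_le_sum_of_subset_of_nonneg ?_ fun e _ _ => (I.cost_pos e).le) hc
    intro e he
    simp only [Finset.mem_sdiff, Finset.mem_symmDiff] at he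
    tauto
  have hr := hO.ratio_le hε (isBalanced_symmDiff hY)
    (by rw [sum_arcCost, mul_zero, add_zero]; exact hsub)
  have hXc : ∑ e ∈ symmDiff F Y, I.arcCost ε F e ≤ I.C + I.cost e₁ := by
    rw [sum_arcCost]
    linarith [card_mul_le hε (symmDiff F Y ∩ F), hsmall e₁]
  rw [sum_arcDelay, symmDiff_symmDiff_cancel_left] at hr
  have hcO : 0 ≤ I.resCost ε F O := by
    rw [resCost_eq_sum hO.1.1]
    exact sum_arcCost_nonneg hε
  have h₁ := mul_le_mul_of_nonpos_left hXc hneg.le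
  have h₂ := mul_le_mul_of_nonneg_right (sub_le_sub_right hd (∑ e ∈ F, I.delay e)) hcO
  have h₃ : (∑ e ∈ symmDiff F O.toFinset, I.cost e - ∑ e ∈ F, I.cost e) *
      (∑ e ∈ F, I.delay e - I.D) ≤
      (I.resCost ε F O - I.cost e₁) * (∑ e ∈ F, I.delay e - I.D) :=
    mul_le_mul_of_nonneg_right (by linarith) (by linarith)
  have h₄ : -I.resDelay F O * I.cost e₁ ≤ (∑ e ∈ F, I.delay e - I.D) * I.cost e₁ :=
    mul_le_mul_of_nonneg_right (by linarith) (I.cost_pos e₁).le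
  have h₅ : ∑ e ∈ F, I.delay e - ∑ e ∈ symmDiff F O.toFinset, I.delay e = -I.resDelay F O := by
    linarith
  rw [h₅]
  linarith

end Residual

end KBCP

namespace KBCP

variable {V E : Type*}

theorem mixed_pos {I : KBCP V E} (e : E) : 0 < I.mixed e :=
  add_pos (div_pos (I.cost_pos e) I.C_pos) (div_pos (I.delay_pos e) I.D_pos)

theorem sum_mixed {I : KBCP V E} (X : Finset E) :
    ∑ e ∈ X, I.mixed e = (∑ e ∈ X, I.cost e) / I.C + (∑ e ∈ X, I.delay e) / I.D := by
  unfold mixed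
  rw [Finset.sum_add_distrib, Finset.sum_div, Finset.sum_div]

theorem exists_small_parameter [Fintype E] (I : KBCP V E) :
    ∃ ε₀ : ℝ, 0 < ε₀ ∧ ∀ ε < ε₀, ∀ e, Fintype.card E * ε < I.cost e := by
  rcases isEmpty_or_nonempty E with hE | hE
  · exact ⟨1, one_pos, fun _ _ e => hE.elim e⟩
  obtain ⟨e₀, he₀⟩ := Finite.exists_min I.cost
  have hm : (0 : ℝ) < Fintype.card E := by exact_mod_cast Fintype.card_pos
  refine ⟨I.cost e₀ / Fintype.card E, div_pos (I.cost_pos e₀) hm, fun ε hε e => ?_⟩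
  rw [lt_div_iff₀' hm] at hε
  exact hε.trans_le (he₀ e)

theorem Integral.small_parameter [Fintype V] [Fintype E] {I : KBCP V E} {ε : ℝ} (h : I.Integral)
    (hε : ε < 1 / ((Fintype.card E : ℝ) * (Fintype.card V : ℝ) * I.D)) (e : E) :
    Fintype.card E * ε < I.cost e := by
  have one_le : ∀ a : ℝ, 0 < a → (∃ z : ℤ, a = z) → 1 ≤ a := by
    rintro _ ha ⟨z, rfl⟩
    exact_mod_cast Int.cast_pos.1 ha
  have hm : (0 : ℝ) < Fintype.card E := by exact_mod_cast Fintype.card_pos_iff.2 ⟨e⟩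
  have hn : (1 : ℝ) ≤ Fintype.card V := by exact_mod_cast Fintype.card_pos_iff.2 ⟨I.s⟩
  have hD := one_le I.D I.D_pos h.2.2.2
  have hnD : 1 ≤ (Fintype.card V : ℝ) * I.D := one_le_mul_of_one_le_of_one_le hn hD
  refine lt_of_lt_of_le ?_ (one_le _ (I.cost_pos e) (h.1 e))
  rw [← lt_div_iff₀' hm]
  refine hε.trans_le (one_div_le_one_div_of_le hm ?_)
  rw [mul_assoc]
  exact le_mul_of_one_le_right hm.le hnD

section Paths

variable [DecidableEq E] {I : KBCP V E} {P : Fin I.k → List E}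

theorem IsDisjointPaths.sum_edges {R : Type*} [AddCommMonoid R] (hP : I.IsDisjointPaths P)
    (w : E → R) : ∑ e ∈ I.edges P, w e = ∑ i, ∑ e ∈ (P i).toFinset, w e := by
  refine Finset.sum_biUnion fun i _ j _ hij => ?_
  exact List.disjoint_toFinset_iff_disjoint.2 (hP.2 hij)

theorem IsDisjointPaths.pathSum_eq (hP : I.IsDisjointPaths P) (w : E → ℝ) :
    I.pathSum w P = ∑ e ∈ I.edges P, w e := by
  rw [hP.sum_edges]
  exact Finset.sum_congr rfl fun i _ => (List.sum_toFinset _ (hP.1 i).nodup).symm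

theorem IsDisjointPaths.isFlow (hP : I.IsDisjointPaths P) :
    IsFlow I.src I.tgt I.s I.t I.k (I.edges P) := by
  intro v
  rw [hP.sum_edges, Finset.sum_congr rfl fun i _ => (hP.1 i).isFlow_one v, Finset.sum_const,
    Finset.card_univ, Fintype.card_fin, nsmul_eq_mul, Nat.cast_one, one_mul]

theorem exists_isDisjointPaths_of_isFlow [Fintype V] {X : Finset E}
    (hX : IsFlow I.src I.tgt I.s I.t I.k X) (ha : IsAcyclicSet I.src I.tgt X) :
    ∃ Q, I.IsDisjointPaths Q ∧ I.edges Q = X := by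
  obtain ⟨Q, h₁, h₂, h₃⟩ := hX.exists_paths I.s_ne_t ha
  exact ⟨Q, ⟨h₁, h₂⟩, h₃⟩

theorem IsBasicOutput.isAcyclicSet [Fintype V] (h : I.IsBasicOutput P) :
    IsAcyclicSet I.src I.tgt (I.edges P) := by
  intro l hl hlX
  have hsub : l.toFinset ⊆ I.edges P := fun e he => hlX e (List.mem_toFinset.1 he)
  have hflow : IsFlow I.src I.tgt I.s I.t I.k (I.edges P \ l.toFinset) := fun v => by
    have := h.1.isFlow v
    rwa [← Finset.sum_sdiff hsub, hl.isBalanced v, add_zero] at this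
  obtain ⟨Y, hY, hYf, hYa⟩ := hflow.exists_acyclic_subset
  obtain ⟨Q, hQ, rfl⟩ := exists_isDisjointPaths_of_isFlow hYf hYa
  have hle := h.2 Q hQ
  rw [h.1.pathSum_eq, hQ.pathSum_eq, ← Finset.sum_sdiff hsub] at hle
  have h₁ := Finset.sum_le_sum_of_subset_of_nonneg hY fun e _ _ => (mixed_pos (I := I) e).le
  have h₂ : 0 < ∑ e ∈ l.toFinset, I.mixed e :=
    Finset.sum_pos (fun e _ => mixed_pos e) (List.toFinset_nonempty_iff l |>.2 hl.1)
  linarith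

theorem exists_isBasicOutput [Fintype E] (hI : I.Feasible) : ∃ P, I.IsBasicOutput P := by
  obtain ⟨P₀, hP₀, -⟩ := hI
  obtain ⟨A, ⟨P, hP, rfl⟩, hmin⟩ := Set.exists_min_image
    {A : Finset E | ∃ P, I.IsDisjointPaths P ∧ I.edges P = A}
    (fun A => ∑ e ∈ A, I.mixed e) (Set.toFinite _) ⟨_, P₀, hP₀, rfl⟩
  refine ⟨P, hP, fun Q hQ => ?_⟩
  rw [hP.pathSum_eq, hQ.pathSum_eq]
  exact hmin _ ⟨Q, hQ, rfl⟩

end Paths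

section Termination

variable [Fintype E] (I : KBCP V E)

/-- the number of sets of edges whose delay is less than that of `F` -/
noncomputable def delayRank (F : Finset E) : ℕ :=
  Set.ncard {X : Finset E | ∑ e ∈ X, I.delay e < ∑ e ∈ F, I.delay e}

theorem delayRank_lt {F F' : Finset E} (h : ∑ e ∈ F', I.delay e < ∑ e ∈ F, I.delay e) :
    I.delayRank F' < I.delayRank F := by
  refine Set.ncard_lt_ncard ⟨fun X hX => lt_trans hX h, fun hsub => ?_⟩ (Set.toFinite _)
  exact lt_irrefl (∑ e ∈ F', I.delay e) (hsub h)

theorem delayRank_le (F : Finset E) : I.delayRank F ≤ Fintype.card (Finset E) := by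
  rw [← Nat.card_eq_fintype_card, ← Set.ncard_univ]
  exact Set.ncard_le_ncard (Set.subset_univ _)

variable [DecidableEq E]

/-- A bound for the number of remaining steps of the algorithm. -/
noncomputable def stepBound : Config E I.k → ℕ
  | .start => 2 * Fintype.card (Finset E) + 2
  | .paths P => 2 * I.delayRank (I.edges P) + 1
  | .cycle P O => 2 * I.delayRank (symmDiff (I.edges P) O.toFinset) + 2
  | .returned _ => 0

variable {I}

theorem Step.stepBound_lt {β ε : ℝ} {x y : Config E I.k} (h : I.Step β ε x y) :
    I.stepBound y < I.stepBound x := by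
  cases h with
  | basic P h =>
    have := I.delayRank_le (I.edges P)
    simp only [stepBound]
    omega
  | halt P h =>
    simp only [stepBound]
    omega
  | choose P O h hO =>
    have hneg := hO.1.2.2
    rw [resDelay_eq_sum hO.1.1, sum_arcDelay, sub_neg] at hneg
    have := I.delayRank_lt hneg
    simp only [stepBound]
    omega
  | cancel P Q O hQ h =>
    simp only [stepBound, h]
    omega

theorem not_exists_infinite_run (β ε : ℝ) :
    ¬ ∃ r : ℕ → Config E I.k, r 0 = .start ∧ ∀ n, I.Step β ε (r n) (r (n + 1)) := by
  rintro ⟨r, -, hr⟩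
  exact not_strictAnti_of_wellFoundedLT (fun n => I.stepBound (r n))
    (strictAnti_nat_of_succ_lt fun n => (hr n).stepBound_lt)

end Termination

section Approximation

variable [DecidableEq E]

/-- What the algorithm maintains about the set `F` of the edges of the current paths. -/
structure IsCheapSet (I : KBCP V E) (β : ℝ) (F : Finset E) : Prop where
  acyclic : IsAcyclicSet I.src I.tgt F
  cost_le : (∑ e ∈ F, I.cost e) / I.C ≤ max 2 (1 + Real.log (1 / β))
  cost_le_neg_log : I.D < ∑ e ∈ F, I.delay e →
    (∑ e ∈ F, I.cost e) / I.C ≤ -Real.log ((∑ e ∈ F, I.delay e) / I.D - 1)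

/-- What holds in each configuration that the algorithm can reach. -/
def Invariant (I : KBCP V E) (β ε : ℝ) : Config E I.k → Prop
  | .start => True
  | .paths P => I.IsDisjointPaths P ∧ I.IsCheapSet β (I.edges P)
  | .cycle P O => I.IsDisjointPaths P ∧ I.IsCheapSet β (I.edges P) ∧
      (1 + β) * I.D < I.pathSum I.delay P ∧ I.IsBestCycle ε (I.edges P) O
  | .returned P => I.IsDisjointPaths P ∧ I.pathSum I.delay P ≤ (1 + β) * I.D ∧
      I.pathSum I.cost P ≤ max 2 (1 + Real.log (1 / β)) * I.C

variable {I : KBCP V E} {β ε : ℝ} {F : Finset E} {O : List E}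

theorem IsBasicOutput.isCheapSet [Fintype V] {P : Fin I.k → List E} (h : I.IsBasicOutput P)
    (hI : I.Feasible) : I.IsCheapSet β (I.edges P) := by
  obtain ⟨Q, hQ, hc, hd⟩ := hI
  have hle := h.2 Q hQ
  rw [hQ.pathSum_eq] at hc hd
  rw [h.1.pathSum_eq, hQ.pathSum_eq, sum_mixed, sum_mixed] at hle
  have h₁ := (div_le_one I.C_pos).2 hc
  have h₂ := (div_le_one I.D_pos).2 hd
  refine ⟨h.isAcyclicSet, le_max_of_le_left ?_, fun hlt => ?_⟩
  · have : 0 ≤ (∑ e ∈ I.edges P, I.delay e) / I.D :=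
      div_nonneg (Finset.sum_nonneg fun e _ => (I.delay_pos e).le) I.D_pos.le
    linarith
  · have hx : 0 < (∑ e ∈ I.edges P, I.delay e) / I.D - 1 := by
      rw [sub_pos, one_lt_div I.D_pos]
      exact hlt
    linarith [Real.log_le_sub_one_of_pos hx]

theorem IsCheapSet.symmDiff [Fintype V] [Fintype E] (hF : I.IsCheapSet β F) (hβ : 0 < β)
    (hε : 0 ≤ ε) (hsmall : ∀ e, Fintype.card E * ε < I.cost e)
    (hlt : (1 + β) * I.D < ∑ e ∈ F, I.delay e) (hO : I.IsBestCycle ε F O) {Y : Finset E}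
    (hY : ∀ v, ∑ e ∈ Y, netOut I.src I.tgt v e = ∑ e ∈ F, netOut I.src I.tgt v e)
    (hc : ∑ e ∈ Y, I.cost e ≤ I.C) (hd : ∑ e ∈ Y, I.delay e ≤ I.D) :
    I.IsCheapSet β (symmDiff F O.toFinset) := by
  have hx : β < (∑ e ∈ F, I.delay e) / I.D - 1 := by
    rw [lt_sub_iff_add_lt', lt_div_iff₀ I.D_pos]
    exact hlt
  have hFD : I.D < ∑ e ∈ F, I.delay e := by
    have := (lt_div_iff₀ I.D_pos).1 (lt_sub_iff_add_lt'.1 (hβ.trans hx))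
    linarith
  have hlog := hF.cost_le_neg_log hFD
  refine ⟨hO.isAcyclicSet_symmDiff hF.acyclic hε hsmall, le_max_of_le_right ?_, fun hD => ?_⟩
  · have h₁ := (sum_cost_symmDiff_le hO.1.1).trans (add_le_add_right hO.1.2.1 _)
    have h₂ := div_le_div_of_nonneg_right h₁ I.C_pos.le
    rw [add_div, div_self I.C_pos.ne'] at h₂
    have h₃ := Real.log_le_log hβ hx.le
    rw [one_div, Real.log_inv]
    linarith
  · have hinc := hO.cost_increase_le hε hsmall hY hc hd hD.le
    set x := (∑ e ∈ F, I.delay e) / I.D - 1 with hxdef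
    set x' := (∑ e ∈ _root_.symmDiff F O.toFinset, I.delay e) / I.D - 1 with hx'def
    have hx0 : 0 < x := hβ.trans hx
    have hx'0 : 0 < x' := by
      rw [hx'def, sub_pos, one_lt_div I.D_pos]
      exact hD
    have hFx : ∑ e ∈ F, I.delay e = I.D * (x + 1) := by
      rw [hxdef, sub_add_cancel, mul_div_cancel₀ _ I.D_pos.ne']
    have hFx' : ∑ e ∈ _root_.symmDiff F O.toFinset, I.delay e = I.D * (x' + 1) := by
      rw [hx'def, sub_add_cancel, mul_div_cancel₀ _ I.D_pos.ne']
    rw [hFx, hFx'] at hinc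
    have h₁ : (∑ e ∈ _root_.symmDiff F O.toFinset, I.cost e - ∑ e ∈ F, I.cost e) / I.C ≤
        1 - x' / x := by
      rw [div_le_iff₀ I.C_pos, one_sub_div hx0.ne', div_mul_eq_mul_div, le_div_iff₀ hx0]
      refine le_of_mul_le_mul_left ?_ I.D_pos
      linarith
    have h₂ := Real.log_le_sub_one_of_pos (div_pos hx'0 hx0)
    rw [Real.log_div hx'0.ne' hx0.ne'] at h₂
    rw [sub_div] at h₁
    linarith

variable [Fintype V] [Fintype E]

theorem Step.invariant (hI : I.Feasible) (hβ : 0 < β) (hε : 0 ≤ ε)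
    (hsmall : ∀ e, Fintype.card E * ε < I.cost e) {x y : Config E I.k} (h : I.Step β ε x y)
    (hx : I.Invariant β ε x) : I.Invariant β ε y := by
  cases h with
  | basic P h => exact ⟨h.1, h.isCheapSet hI⟩
  | halt P h =>
    refine ⟨hx.1, h, ?_⟩
    rw [hx.1.pathSum_eq, ← div_le_iff₀ I.C_pos]
    exact hx.2.cost_le
  | choose P O h hO => exact ⟨hx.1, hx.2, h, hO⟩
  | cancel P Q O hQ h =>
    obtain ⟨hP, hcheap, hlt, hO⟩ := hx
    obtain ⟨Q', hQ', hc, hd⟩ := hI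
    rw [hP.pathSum_eq] at hlt
    rw [hQ'.pathSum_eq] at hc hd
    refine ⟨hQ, ?_⟩
    rw [h]
    exact hcheap.symmDiff hβ hε hsmall hlt hO
      (fun v => (hQ'.isFlow v).trans (hP.isFlow v).symm) hc hd

theorem Invariant.exists_step (hI : I.Feasible) (hβ : 0 < β) (hε : 0 ≤ ε)
    (hsmall : ∀ e, Fintype.card E * ε < I.cost e) {x : Config E I.k}
    (hx : I.Invariant β ε x) : (∃ y, I.Step β ε x y) ∨ ∃ P, x = .returned P := by
  cases x with
  | start =>
    obtain ⟨P, hP⟩ := exists_isBasicOutput hI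
    exact .inl ⟨_, .basic P hP⟩
  | paths P =>
    rcases le_or_gt (I.pathSum I.delay P) ((1 + β) * I.D) with h | h
    · exact .inl ⟨_, .halt P h⟩
    obtain ⟨Q, hQ, hc, hd⟩ := hI
    obtain ⟨O, hO⟩ := exists_isBestCycle ε hx.2.acyclic hε
      (fun v => (hQ.isFlow v).trans (hx.1.isFlow v).symm)
      (by rwa [← hQ.pathSum_eq]) (by
        rw [← hQ.pathSum_eq, ← hx.1.pathSum_eq]
        linarith [mul_pos hβ I.D_pos])
    exact .inl ⟨_, .choose P O h hO⟩
  | cycle P O =>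
    obtain ⟨hP, hcheap, hlt, hO⟩ := hx
    obtain ⟨Q, hQ, hQe⟩ := exists_isDisjointPaths_of_isFlow
      (fun v => (sum_netOut_symmDiff hO.1.1 v).trans (hP.isFlow v))
      (hO.isAcyclicSet_symmDiff hcheap.acyclic hε hsmall)
    exact .inl ⟨_, .cancel P Q O hQ hQe⟩
  | returned P => exact .inr ⟨P, rfl⟩

/-- The algorithm is a bifactor approximation as soon as any number of reversed edges costs less
than any single edge. -/
theorem isBifactorApproxOn_of_small (hI : I.Feasible) (hβ : 0 < β) (hε : 0 ≤ ε)
    (hsmall : ∀ e, Fintype.card E * ε < I.cost e) :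
    IsBifactorApproxOn I (I.Step β ε) (1 + β) (max 2 (1 + Real.log (1 / β))) := by
  refine ⟨not_exists_infinite_run β ε, fun x hrun hstuck => ?_⟩
  have hx : I.Invariant β ε x := by
    clear hstuck
    induction hrun with
    | refl => exact trivial
    | tail _ h ih => exact h.invariant hI hβ hε hsmall ih
  rcases hx.exists_step hI hβ hε hsmall with ⟨y, hy⟩ | ⟨P, rfl⟩
  · exact absurd hy (hstuck y)
  · exact ⟨P, rfl, hx⟩

end Approximation

end KBCP

theorem theorem2 {V E : Type*} [Fintype V] [Fintype E] [DecidableEq E]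
    (I : KBCP V E) (hI : I.Feasible) :
    (∃ ε₀ : ℝ, 0 < ε₀ ∧ ∀ ε : ℝ, 0 ≤ ε → ε < ε₀ → ∀ β : ℝ, 0 < β → β ≤ 1 →
      IsBifactorApproxOn I (I.Step β ε) (1 + β) (max 2 (1 + Real.log (1 / β)))) ∧
    (I.Integral → ∀ ε : ℝ, 0 < ε →
      ε < 1 / ((Fintype.card E : ℝ) * (Fintype.card V : ℝ) * I.D) → ∀ β : ℝ, 0 < β → β ≤ 1 →
      IsBifactorApproxOn I (I.Step β ε) (1 + β) (max 2 (1 + Real.log (1 / β)))) := by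
  refine ⟨?_, fun hint ε hε hεm β hβ _ =>
    KBCP.isBifactorApproxOn_of_small hI hβ hε.le (hint.small_parameter hεm)⟩
  obtain ⟨ε₀, hpos, hsmall⟩ := I.exists_small_parameter
  exact ⟨ε₀, hpos, fun ε hε hlt β hβ _ =>
    KBCP.isBifactorApproxOn_of_small hI hβ hε (hsmall ε hlt)⟩
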